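/- Let $S_\infty$ be the group of permutations of $\mathbb{Z}_{>0}$ that fix all but finitely many elements. For $w\in S_\infty$ let $\mathfrak{S}_w\in\mathbb{Z}[x_1,x_2,\ldots]$ be its Schubert polynomial: if $w\in S_n$, then $\mathfrak{S}_{w_0}=x_1^{n-1}x_2^{n-2}\cdots x_{n-1}$ for the longest element $w_0$ of $S_n$, and $\mathfrak{S}_w=\partial_i\mathfrak{S}_{ws_i}$ whenever $1\le i<n$ and $w(i)<w(i+1)$, where $s_i$ is the transposition exchanging $i$ and $i+1$ and $\partial_i f=(f-s_if)/(x_i-x_{i+1})$ is the divided difference operator. (This does not depend on the choice of $n$ or of $i$.) For $u\in S_k$ with $u(k)\neq k$ let $$p_u(w)=\#\{a_1<a_2<\cdots<a_k \text{ in } \mathbb{Z}_{>0}\ :\ w(a_i)<w(a_j)\iff u(i)<u(j)\ \text{ for all } 1\le i<j\le k\},$$ which is finite, be the number of occurrences of the pattern $u$ in $w$. Then for every $w\in S_\infty$ the principal specialization of $\mathfrak{S}_w$ satisfies $$\mathfrak{S}_w(1,1,\ldots)\ \ge\ 1+p_{132}(w)+p_{1432}(w).$$ -/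

import Mathlib

/-!
Conventions. Positions, values and variables are indexed from `0`: the positive integer `m` is
represented by the natural number `m - 1`, so that `X i` is the variable usually called `x_{i+1}`.
An element of `S_∞` is a `w : Equiv.Perm ℕ` such that `{m | w m ≠ m}` is finite.
-/

namespace Schubert

open MvPolynomial

/-- The adjacent transposition exchanging `i` and `i + 1`. -/
def adj (i : ℕ) : Equiv.Perm ℕ := Equiv.swap i (i + 1)

/-- `f - s_i f` is divisible by `x_i - x_{i+1}`. -/
theorem X_sub_X_dvd (i : ℕ) (f : MvPolynomial ℕ ℤ) :
    (X i - X (i + 1) : MvPolynomial ℕ ℤ) ∣ f - rename (adj i) f := by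
  rw [← Ideal.mem_span_singleton, ← Ideal.Quotient.mk_eq_mk_iff_sub_mem]
  set I : Ideal (MvPolynomial ℕ ℤ) := Ideal.span {X i - X (i + 1)} with hI
  have hX : Ideal.Quotient.mkₐ ℤ I (X i) = Ideal.Quotient.mkₐ ℤ I (X (i + 1)) := by
    simp only [Ideal.Quotient.mkₐ_eq_mk]
    exact (Ideal.Quotient.mk_eq_mk_iff_sub_mem _ _).2 (Ideal.mem_span_singleton_self _)
  have h : Ideal.Quotient.mkₐ ℤ I = (Ideal.Quotient.mkₐ ℤ I).comp (rename (adj i)) := by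
    apply MvPolynomial.algHom_ext
    intro j
    rw [AlgHom.comp_apply, rename_X, adj]
    rcases eq_or_ne j i with rfl | h1
    · rw [Equiv.swap_apply_left, hX]
    rcases eq_or_ne j (i + 1) with rfl | h2
    · rw [Equiv.swap_apply_right, hX]
    rw [Equiv.swap_apply_of_ne_of_ne h1 h2]
  exact DFunLike.congr_fun h f

/-- The divided difference `∂_i f = (f - s_i f) / (x_i - x_{i+1})`: the unique polynomial `g` with
`f - s_i f = (x_i - x_{i+1}) * g`. -/
noncomputable def divDiff (i : ℕ) (f : MvPolynomial ℕ ℤ) : MvPolynomial ℕ ℤ :=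
  (X_sub_X_dvd i f).choose

theorem divDiff_spec (i : ℕ) (f : MvPolynomial ℕ ℤ) :
    f - rename (adj i) f = (X i - X (i + 1)) * divDiff i f :=
  (X_sub_X_dvd i f).choose_spec

/-- The defining equation determines the divided difference. -/
theorem divDiff_unique (i : ℕ) (f g : MvPolynomial ℕ ℤ)
    (h : f - rename (adj i) f = (X i - X (i + 1)) * g) : divDiff i f = g := by
  have h0 : (X i - X (i + 1) : MvPolynomial ℕ ℤ) ≠ 0 := by
    rw [sub_ne_zero]
    intro h
    have := X_injective h
    omega
  exact mul_left_cancel₀ h0 ((divDiff_spec i f).symm.trans h)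

/-- The pairs of positions `a < b < n` at which `w` is increasing. -/
def nonInversions (n : ℕ) (w : Equiv.Perm ℕ) : Finset (ℕ × ℕ) :=
  (Finset.range n ×ˢ Finset.range n).filter fun p => p.1 < p.2 ∧ w p.1 < w p.2

theorem mem_nonInversions {n : ℕ} {w : Equiv.Perm ℕ} {a b : ℕ} :
    (a, b) ∈ nonInversions n w ↔ (a < n ∧ b < n) ∧ a < b ∧ w a < w b := by
  simp [nonInversions]

/-- Exchanging the values at an ascent creates an inversion. -/
theorem card_nonInversions_lt {n i : ℕ} {w : Equiv.Perm ℕ} (hi : i + 1 < n)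
    (hw : w i < w (i + 1)) :
    (nonInversions n (w * adj i)).card < (nonInversions n w).card := by
  have hadj : ∀ m, adj i m = if m = i then i + 1 else if m = i + 1 then i else m := by
    intro m
    exact Equiv.swap_apply_def _ _ _
  have hmem : (i, i + 1) ∈ nonInversions n w :=
    mem_nonInversions.2 ⟨⟨by omega, hi⟩, by omega, hw⟩
  have hle : (nonInversions n (w * adj i)).card ≤ ((nonInversions n w).erase (i, i + 1)).card := by
    apply Finset.card_le_card_of_injOn (fun p => (adj i p.1, adj i p.2))
    · rintro ⟨a, b⟩ hp
      rw [Finset.mem_coe] at hp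
      obtain ⟨⟨ha, hb⟩, hab, hwab⟩ := mem_nonInversions.1 hp
      simp only [Equiv.Perm.mul_apply] at hwab
      have hne : ¬ (a = i ∧ b = i + 1) := by
        rintro ⟨rfl, rfl⟩
        simp only [hadj] at hwab
        simp at hwab
        omega
      rw [Finset.mem_coe, Finset.mem_erase, mem_nonInversions, Ne, Prod.mk.injEq]
      refine ⟨?_, ⟨?_, ?_⟩, ?_, hwab⟩
      all_goals
        rw [hadj]
        try rw [hadj]
        split_ifs <;> omega
    · rintro ⟨a, b⟩ _ ⟨c, d⟩ _ h
      simpa using h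
  exact lt_of_le_of_lt hle (Finset.card_erase_lt_of_mem hmem)

/-- The positions `i` with `i + 1 < n` at which `w` has an ascent. -/
def ascents (n : ℕ) (w : Equiv.Perm ℕ) : Set ℕ :=
  {i | i + 1 < n ∧ w i < w (i + 1)}

open Classical in
/-- The Schubert polynomial of a permutation `w` of `{0, …, n - 1}` (a `w : Equiv.Perm ℕ` fixing
all `m ≥ n`), by descending induction from the longest element:
* if `w` has an ascent below `n`, it is `∂_i` of the Schubert polynomial of `w s_i`, where `i` is
  the first ascent of `w` (by the braid relations every ascent gives the same polynomial);
* otherwise `w` is the longest element of `S_n`, and it is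
  `x_0 ^ (n-1) * x_1 ^ (n-2) * ⋯ * x_{n-2}`. -/
noncomputable def schubertIn (n : ℕ) (w : Equiv.Perm ℕ) : MvPolynomial ℕ ℤ :=
  if _h : (ascents n w).Nonempty then
    divDiff (sInf (ascents n w)) (schubertIn n (w * adj (sInf (ascents n w))))
  else
    ∏ i ∈ Finset.range n, X i ^ (n - 1 - i)
termination_by (nonInversions n w).card
decreasing_by exact card_nonInversions_lt (Nat.sInf_mem _h).1 (Nat.sInf_mem _h).2

/-- The Schubert polynomial of `w ∈ S_∞`, computed in the smallest `S_n` that contains `w`.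
(By stability every `S_n` that contains `w` gives the same polynomial.) -/
noncomputable def schubert (w : Equiv.Perm ℕ) : MvPolynomial ℕ ℤ :=
  schubertIn (sInf {n : ℕ | ∀ m, n ≤ m → w m = m}) w

/-- For finitely supported `w`, the index used in `schubert` is indeed that of an `S_n`
containing `w`. -/
theorem fixes_of_sInf_le {w : Equiv.Perm ℕ} (hw : {m | w m ≠ m}.Finite) (m : ℕ)
    (hm : sInf {n : ℕ | ∀ m, n ≤ m → w m = m} ≤ m) : w m = m := by
  have hne : {n : ℕ | ∀ m, n ≤ m → w m = m}.Nonempty := by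
    obtain ⟨N, hN⟩ := hw.bddAbove
    refine ⟨N + 1, fun m hm => ?_⟩
    by_contra h
    have := hN h
    omega
  exact Nat.sInf_mem hne m hm

/-- The occurrences of the pattern `u ∈ S_k` in `w`: the increasing sequences of positions
`a_0 < ⋯ < a_{k-1}` at which the values of `w` are in the same relative order as those of `u`. -/
def occurrences {k : ℕ} (u : Equiv.Perm (Fin k)) (w : Equiv.Perm ℕ) : Set (Fin k → ℕ) :=
  {a | StrictMono a ∧ ∀ i j, i < j → (w (a i) < w (a j) ↔ u i < u j)}

/-- The number `p_u(w)` of occurrences of `u` in `w`. -/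
noncomputable def patternCount {k : ℕ} (u : Equiv.Perm (Fin k)) (w : Equiv.Perm ℕ) : ℕ :=
  (occurrences u w).ncard

/-- A pattern that does not fix its last letter has only finitely many occurrences in a `w ∈ S_∞`,
so that `patternCount u w` is a genuine count. -/
theorem occurrences_finite {k : ℕ} (u : Equiv.Perm (Fin (k + 1)))
    (hu : u (Fin.last k) ≠ Fin.last k) {w : Equiv.Perm ℕ} (hw : {m | w m ≠ m}.Finite) :
    (occurrences u w).Finite := by
  obtain ⟨N, hN⟩ := hw.bddAbove
  have hfix : ∀ m, N < m → w m = m := by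
    intro m hm
    by_contra h
    have := hN h
    omega
  have hsub : occurrences u w ⊆ Set.pi Set.univ fun _ => Set.Iic N := by
    rintro a ⟨ha, hau⟩ j -
    have hj : a j ≤ a (Fin.last k) := ha.monotone (Fin.le_last j)
    suffices a (Fin.last k) ≤ N from le_trans hj this
    by_contra hlast
    push Not at hlast
    set i := u.symm (Fin.last k) with hi
    have hui : u i = Fin.last k := by simp [hi]
    have hlt : i < Fin.last k := by
      refine lt_of_le_of_ne (Fin.le_last i) fun h => hu ?_
      rw [← h, hui, h]
    have h1 : ¬ w (a i) < w (a (Fin.last k)) := by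
      rw [hau i _ hlt, hui]
      exact not_lt.2 (Fin.le_last _)
    rw [hfix _ hlast] at h1
    have h2 : w (a i) = a i := w.injective (hfix _ (by omega))
    have h3 := ha hlt
    omega
  exact (Set.Finite.pi' fun _ => Set.finite_Iic N).subset fun a ha i => hsub ha i (Set.mem_univ i)

/-- The pattern `132`. -/
def pattern132 : Equiv.Perm (Fin 3) := Equiv.swap 1 2

/-- The pattern `1432`. -/
def pattern1432 : Equiv.Perm (Fin 4) := Equiv.swap 1 3

end Schubert

/-! The proof is an induction along Lascoux's transition formula, inside one fixed `S_n`, so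
stability is never needed. Let `r` be the last descent of `w`, `s` the last position with a value
below `w r`, and `v = w * swap r s`. Monk's rule for `X r` times the polynomial of `v` has `w` as
its only positive term. At `x = 1` this reads `𝔖_w = 𝔖_v + ∑_j 𝔖_{u_j}`, where `u_j = v * swap r j`
and `j < r` ranges over the positions for which `u_j` is covered by `v`
(`IsLastInversion.eval_transition`).

Passing from `w` to `v` destroys at most the occurrences of 132 ending at `r, s` and those of 1432
ending at `r, s`. These are recorded by `lostPairs`: `b = r` for 132, `b < r` for 1432. Every lost
pair `(a, b)` is attached to some index `j` of the sum with `a ≤ j` and `w a ≤ w j`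
(`exists_isCover`). At most `1 + p_132(u_j) + p_1432(u_j)` pairs are attached to a given `j`
(`card_lostPairs_filter_le`), and by induction this is at most `𝔖_{u_j}(1, 1, …)`. So the sum over
`j` pays for the loss.

Monk's rule is itself proved by descent from `w_0`: `∂_i` carries the rule for `w s_i` to the rule
for `w`, and the base cases are identities between the monomials of dominant permutations. -/

namespace Schubert

open MvPolynomial

/-! ### Divided differences and their braid relations -/

section DividedDifferences

theorem adj_mul_self (i : ℕ) : adj i * adj i = 1 := Equiv.swap_mul_self _ _

theorem adj_apply (i m : ℕ) :
    adj i m = if m = i then i + 1 else if m = i + 1 then i else m :=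
  Equiv.swap_apply_def _ _ _

@[simp]
theorem adj_left (i : ℕ) : adj i i = i + 1 := Equiv.swap_apply_left _ _

@[simp]
theorem adj_right (i : ℕ) : adj i (i + 1) = i := Equiv.swap_apply_right _ _

@[simp]
theorem adj_adj (i m : ℕ) : adj i (adj i m) = m := Equiv.swap_apply_self _ _ _

theorem mul_adj_adj (w : Equiv.Perm ℕ) (i : ℕ) : w * adj i * adj i = w := by
  rw [mul_assoc, adj_mul_self, mul_one]

theorem adj_comm {i j : ℕ} (h : i + 1 < j) : adj i * adj j = adj j * adj i := by
  ext m
  simp only [Equiv.Perm.mul_apply, adj_apply]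
  split_ifs <;> omega

theorem adj_braid (i : ℕ) :
    adj i * adj (i + 1) * adj i = adj (i + 1) * adj i * adj (i + 1) := by
  ext m
  simp only [Equiv.Perm.mul_apply, adj_apply]
  split_ifs <;> omega

/-- The action of `adj i` on polynomials by exchanging variables. -/
noncomputable def act (i : ℕ) : MvPolynomial ℕ ℤ →ₐ[ℤ] MvPolynomial ℕ ℤ := rename (adj i)

theorem act_X (i j : ℕ) : act i (X j) = X (adj i j) := rename_X _ _

@[simp]
theorem act_act (i : ℕ) (f : MvPolynomial ℕ ℤ) : act i (act i f) = f := by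
  have : (adj i : ℕ → ℕ) ∘ adj i = id := by ext; simp
  rw [act, rename_rename, this, rename_id_apply]

theorem act_comm {i j : ℕ} (h : i + 1 < j) (f : MvPolynomial ℕ ℤ) :
    act i (act j f) = act j (act i f) := by
  simp only [act, rename_rename, ← Equiv.Perm.coe_mul, adj_comm h]

theorem act_braid (i : ℕ) (f : MvPolynomial ℕ ℤ) :
    act i (act (i + 1) (act i f)) = act (i + 1) (act i (act (i + 1) f)) := by
  simp only [act, rename_rename, ← Equiv.Perm.coe_mul, adj_braid, ← mul_assoc]

theorem sub_act (i : ℕ) (f : MvPolynomial ℕ ℤ) :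
    f - act i f = (X i - X (i + 1)) * divDiff i f :=
  divDiff_spec i f

theorem X_sub_X_ne_zero {i j : ℕ} (h : i ≠ j) : (X i - X j : MvPolynomial ℕ ℤ) ≠ 0 := by
  rw [sub_ne_zero]
  exact fun e => h (X_injective e)

theorem divDiff_eq {i : ℕ} {f g : MvPolynomial ℕ ℤ}
    (h : f - act i f = (X i - X (i + 1)) * g) : divDiff i f = g :=
  divDiff_unique i f g h

theorem act_divDiff (i : ℕ) (f : MvPolynomial ℕ ℤ) : act i (divDiff i f) = divDiff i f := by
  symm
  apply divDiff_eq
  have h := congrArg (act i) (sub_act i f)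
  simp only [map_sub, map_mul, act_act, act_X, adj_left, adj_right] at h
  linear_combination -h

theorem divDiff_eq_zero {i : ℕ} {f : MvPolynomial ℕ ℤ} (h : act i f = f) : divDiff i f = 0 :=
  divDiff_eq (by rw [h]; ring)

theorem divDiff_divDiff (i : ℕ) (f : MvPolynomial ℕ ℤ) : divDiff i (divDiff i f) = 0 :=
  divDiff_eq_zero (act_divDiff i f)

/-- The divided difference as an additive map. -/
noncomputable def divDiffHom (i : ℕ) : MvPolynomial ℕ ℤ →+ MvPolynomial ℕ ℤ where
  toFun := divDiff i
  map_zero' := divDiff_eq_zero (map_zero _)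
  map_add' f g := divDiff_eq (by
    rw [map_add]
    linear_combination sub_act i f + sub_act i g)

theorem divDiffHom_apply (i : ℕ) (f : MvPolynomial ℕ ℤ) : divDiffHom i f = divDiff i f := rfl

theorem divDiff_mul (i : ℕ) (f g : MvPolynomial ℕ ℤ) :
    divDiff i (f * g) = act i f * divDiff i g + divDiff i f * g := by
  apply divDiff_eq
  rw [map_mul]
  linear_combination act i f * sub_act i g + g * sub_act i f

theorem divDiff_mul_of_act_eq {i : ℕ} {f : MvPolynomial ℕ ℤ} (hf : act i f = f)
    (g : MvPolynomial ℕ ℤ) : divDiff i (f * g) = f * divDiff i g := by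
  rw [divDiff_mul, hf, divDiff_eq_zero hf, zero_mul, add_zero]

theorem divDiff_X_left (i : ℕ) : divDiff i (X i) = 1 :=
  divDiff_eq (by rw [act_X, adj_left, mul_one])

theorem divDiff_X_right (i : ℕ) : divDiff i (X (i + 1)) = -1 :=
  divDiff_eq (by rw [act_X, adj_right]; ring)

theorem divDiff_X_of_ne {i j : ℕ} (h : j ≠ i) (h' : j ≠ i + 1) : divDiff i (X j) = 0 :=
  divDiff_eq_zero (by rw [act_X, adj_apply, if_neg h, if_neg h'])

theorem act_divDiff_comm {i j : ℕ} (h : i + 1 < j) (f : MvPolynomial ℕ ℤ) :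
    act i (divDiff j f) = divDiff j (act i f) := by
  symm
  apply divDiff_eq
  have e := congrArg (act i) (sub_act j f)
  have h1 : adj i j = j := by rw [adj_apply, if_neg (by omega), if_neg (by omega)]
  have h2 : adj i (j + 1) = j + 1 := by rw [adj_apply, if_neg (by omega), if_neg (by omega)]
  simp only [map_sub, map_mul, act_X, h1, h2, act_comm h] at e
  exact e

theorem divDiff_comm {i j : ℕ} (h : i + 1 < j) (f : MvPolynomial ℕ ℤ) :
    divDiff i (divDiff j f) = divDiff j (divDiff i f) := by
  apply divDiff_eq
  have h3 : act j (X i - X (i + 1)) = X i - X (i + 1) := by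
    rw [map_sub, act_X, act_X, adj_apply, adj_apply, if_neg (by omega), if_neg (by omega),
      if_neg (by omega), if_neg (by omega)]
  rw [act_divDiff_comm h, ← divDiff_mul_of_act_eq h3, ← sub_act, ← divDiffHom_apply,
    ← divDiffHom_apply, ← divDiffHom_apply, map_sub]

theorem divDiff_braid (i : ℕ) (f : MvPolynomial ℕ ℤ) :
    divDiff i (divDiff (i + 1) (divDiff i f)) =
      divDiff (i + 1) (divDiff i (divDiff (i + 1) f)) := by
  have hi : adj i (i + 2) = i + 2 := by
    rw [adj_apply, if_neg (by omega), if_neg (by omega)]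
  have hj : adj (i + 1) i = i := by
    rw [adj_apply, if_neg (by omega), if_neg (by omega)]
  have hl : adj (i + 1) (i + 2) = i + 1 := adj_right (i + 1)
  have spec : ∀ g, g - act (i + 1) g = (X (i + 1) - X (i + 2)) * divDiff (i + 1) g :=
    sub_act (i + 1)
  have h0 : (X i - X (i + 1)) * ((X (i + 1) - X (i + 2)) * (X i - X (i + 2))) ≠
      (0 : MvPolynomial ℕ ℤ) :=
    mul_ne_zero (X_sub_X_ne_zero (by omega))
      (mul_ne_zero (X_sub_X_ne_zero (by omega)) (X_sub_X_ne_zero (by omega)))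
  apply mul_left_cancel₀ h0
  have a1 := sub_act i f
  have a2 := spec (divDiff i f)
  have a3 := sub_act i (divDiff (i + 1) (divDiff i f))
  have a4 := congrArg (act i) a2
  have a5 := congrArg (act (i + 1)) a1
  have a6 := congrArg (act i) a5
  have b1 := spec f
  have b2 := sub_act i (divDiff (i + 1) f)
  have b3 := spec (divDiff i (divDiff (i + 1) f))
  have b4 := congrArg (act (i + 1)) b2
  have b5 := congrArg (act i) b1
  have b6 := congrArg (act (i + 1)) b5
  have c := act_braid i f
  simp only [map_sub, map_mul, act_X, adj_left, adj_right, hi, hj, hl, act_divDiff] at *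
  -- Multiplied by the Vandermonde product in three variables, both sides become the alternating sum
  -- of `f` over `S_3`.
  trans f - act i f - act (i + 1) f + act (i + 1) (act i f) + act i (act (i + 1) f)
    - act i (act (i + 1) (act i f))
  · linear_combination -(X (i + 1) - X (i + 2)) * (X i - X (i + 2)) * a3
      - (X i - X (i + 2)) * a2 + (X (i + 1) - X (i + 2)) * a4 - a1 + a5 - a6
  · rw [c]
    symm
    linear_combination -(X i - X (i + 1)) * (X i - X (i + 2)) * b3
      - (X i - X (i + 2)) * b2 + (X i - X (i + 1)) * b4 - b1 + b5 - b6

end DividedDifferences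

/-! ### Independence of the chosen ascent -/

section Recursion

theorem mul_adj_apply (w : Equiv.Perm ℕ) (i m : ℕ) :
    (w * adj i) m = if m = i then w (i + 1) else if m = i + 1 then w i else w m := by
  rw [Equiv.Perm.mul_apply, adj_apply]
  split_ifs <;> rfl

theorem schubertIn_first_ascent {n : ℕ} {w : Equiv.Perm ℕ} (h : (ascents n w).Nonempty) :
    schubertIn n w =
      divDiff (sInf (ascents n w)) (schubertIn n (w * adj (sInf (ascents n w)))) := by
  rw [schubertIn, dif_pos h]

theorem schubertIn_of_no_ascents {n : ℕ} {w : Equiv.Perm ℕ} (h : ¬ (ascents n w).Nonempty) :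
    schubertIn n w = ∏ i ∈ Finset.range n, X i ^ (n - 1 - i) := by
  rw [schubertIn, dif_neg h]

/-- Every ascent computes the Schubert polynomial. -/
theorem schubertIn_ascent (n : ℕ) (w : Equiv.Perm ℕ) {i : ℕ} (hi : i + 1 < n)
    (hw : w i < w (i + 1)) : schubertIn n w = divDiff i (schubertIn n (w * adj i)) := by
  induction hN : (nonInversions n w).card using Nat.strong_induction_on generalizing w i with
  | _ N ih =>
  subst hN
  have ih' : ∀ {u : Equiv.Perm ℕ} {k : ℕ}, (nonInversions n u).card < (nonInversions n w).card →
      k + 1 < n → u k < u (k + 1) → schubertIn n u = divDiff k (schubertIn n (u * adj k)) :=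
    fun {u k} h1 h2 h3 => ih _ h1 u h2 h3 rfl
  -- Two ascents lead to a common permutation further up, by a braid move if they are adjacent and a
  -- commutation otherwise. The induction hypothesis applies above `w`.
  have diamond : ∀ {j k : ℕ}, j < k → j + 1 < n → k + 1 < n → w j < w (j + 1) →
      w k < w (k + 1) →
      divDiff j (schubertIn n (w * adj j)) = divDiff k (schubertIn n (w * adj k)) := by
    intro j k hjk hj hk wj wk
    have lj := card_nonInversions_lt hj wj
    have lk := card_nonInversions_lt hk wk
    rcases (Nat.succ_le_of_lt hjk).eq_or_lt with h | h
    · obtain rfl : j + 1 = k := h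
      have e1 : (w * adj j) (j + 1) < (w * adj j) (j + 1 + 1) := by
        simp only [mul_adj_apply]
        split_ifs <;> omega
      have e2 : (w * adj (j + 1)) j < (w * adj (j + 1)) (j + 1) := by
        simp only [mul_adj_apply]
        split_ifs <;> omega
      have l1 := card_nonInversions_lt hk e1
      have l2 := card_nonInversions_lt hj e2
      have e3 : (w * adj j * adj (j + 1)) j < (w * adj j * adj (j + 1)) (j + 1) := by
        simp only [mul_adj_apply]
        split_ifs <;> omega
      have e4 : (w * adj (j + 1) * adj j) (j + 1) < (w * adj (j + 1) * adj j) (j + 1 + 1) := by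
        simp only [mul_adj_apply]
        split_ifs <;> omega
      rw [ih' lj hk e1, ih' (l1.trans lj) hj e3, ih' lk hj e2, ih' (l2.trans lk) hk e4,
        divDiff_braid]
      simp only [mul_assoc]
      rw [← mul_assoc (adj j), adj_braid, mul_assoc]
    · replace h : j + 1 < k := h
      have e1 : (w * adj j) k < (w * adj j) (k + 1) := by
        simp only [mul_adj_apply]
        split_ifs <;> omega
      have e2 : (w * adj k) j < (w * adj k) (j + 1) := by
        simp only [mul_adj_apply]
        split_ifs <;> omega
      rw [ih' lj hk e1, ih' lk hj e2, divDiff_comm h, mul_assoc, mul_assoc, adj_comm h]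
  have hne : (ascents n w).Nonempty := ⟨i, hi, hw⟩
  rw [schubertIn_first_ascent hne]
  obtain ⟨h1, h2⟩ := Nat.sInf_mem hne
  rcases (Nat.sInf_le (show i ∈ ascents n w from ⟨hi, hw⟩)).eq_or_lt with h | h
  · rw [h]
  · exact diamond h h1 hi h2 hw

theorem divDiff_schubertIn_of_ascent (n : ℕ) (w : Equiv.Perm ℕ) {i : ℕ} (hi : i + 1 < n)
    (hw : w i < w (i + 1)) : divDiff i (schubertIn n w) = 0 := by
  rw [schubertIn_ascent n w hi hw, divDiff_divDiff]

theorem divDiff_schubertIn_of_descent (n : ℕ) (w : Equiv.Perm ℕ) {i : ℕ} (hi : i + 1 < n)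
    (hw : w (i + 1) < w i) : divDiff i (schubertIn n w) = schubertIn n (w * adj i) := by
  have h : (w * adj i) i < (w * adj i) (i + 1) := by simpa using hw
  rw [schubertIn_ascent n _ hi h, mul_adj_adj]

end Recursion

/-! ### Dominant permutations and their monomials -/

section Dominant

/-- The `i`-th entry of the Lehmer code of `w` restricted to the positions below `n`. -/
def code (n : ℕ) (w : Equiv.Perm ℕ) (i : ℕ) : ℕ :=
  ((Finset.Ioo i n).filter fun j => w j < w i).card

/-- `w` has no occurrence of `132` at positions below `n`. -/
def Dominant (n : ℕ) (w : Equiv.Perm ℕ) : Prop :=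
  ∀ a b c, a < b → b < c → c < n → w a < w c → ¬ w c < w b

theorem code_mul_adj_of_ne {n i j : ℕ} (w : Equiv.Perm ℕ) (hi : i + 1 < n) (h : j ≠ i)
    (h' : j ≠ i + 1) : code n (w * adj i) j = code n w j := by
  have hj : adj i j = j := by rw [adj_apply, if_neg h, if_neg h']
  apply Finset.card_nbij' (adj i) (adj i)
  · intro k hk
    rw [Finset.mem_coe, Finset.mem_filter, Finset.mem_Ioo] at hk ⊢
    simp only [Equiv.Perm.mul_apply, hj] at hk
    refine ⟨?_, hk.2⟩
    rw [adj_apply]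
    split_ifs <;> omega
  · intro k hk
    rw [Finset.mem_coe, Finset.mem_filter, Finset.mem_Ioo] at hk ⊢
    simp only [Equiv.Perm.mul_apply, hj, adj_adj]
    refine ⟨?_, hk.2⟩
    rw [adj_apply]
    split_ifs <;> omega
  · intro k _; simp
  · intro k _; simp

theorem code_mul_adj_right {n i : ℕ} {w : Equiv.Perm ℕ} (hw : w i < w (i + 1)) :
    code n (w * adj i) (i + 1) = code n w i := by
  unfold code
  congr 1
  ext k
  simp only [Finset.mem_filter, Finset.mem_Ioo, mul_adj_apply]
  constructor
  · rintro ⟨h1, h2⟩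
    refine ⟨by omega, ?_⟩
    split_ifs at h2 <;> omega
  · rintro ⟨h1, h2⟩
    have : k ≠ i + 1 := by rintro rfl; omega
    refine ⟨by omega, ?_⟩
    split_ifs <;> omega

theorem code_mul_adj_left {n i : ℕ} {w : Equiv.Perm ℕ} (hi : i + 1 < n)
    (hw : w i < w (i + 1)) : code n (w * adj i) i = code n w (i + 1) + 1 := by
  unfold code
  rw [← Finset.card_insert_of_notMem (a := i + 1) (by simp)]
  congr 1
  ext k
  simp only [Finset.mem_filter, Finset.mem_Ioo, mul_adj_apply, Finset.mem_insert]
  constructor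
  · rintro ⟨h1, h2⟩
    by_cases hk : k = i + 1
    · exact Or.inl hk
    · refine Or.inr ⟨by omega, ?_⟩
      split_ifs at h2 <;> omega
  · rintro (rfl | ⟨h1, h2⟩)
    · refine ⟨by omega, ?_⟩
      split_ifs <;> omega
    · refine ⟨by omega, ?_⟩
      split_ifs <;> omega

/-- A later value strictly between `w i` and `w (i + 1)` would complete a 132. -/
theorem Dominant.code_eq {n i : ℕ} {w : Equiv.Perm ℕ} (h : Dominant n w)
    (hw : w i < w (i + 1)) : code n w i = code n w (i + 1) := by
  unfold code
  congr 1
  ext k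
  simp only [Finset.mem_filter, Finset.mem_Ioo]
  constructor
  · rintro ⟨h1, h2⟩
    have : k ≠ i + 1 := by rintro rfl; omega
    exact ⟨by omega, by omega⟩
  · rintro ⟨h1, h2⟩
    refine ⟨by omega, ?_⟩
    have h3 := h i (i + 1) k (by omega) h1.1 h1.2
    have h4 : w k ≠ w i := fun e => by have := w.injective e; omega
    omega

/-- A new 132 would need its last two letters at `i, i + 1` and an earlier value below `w i`, which
`hmin` excludes. -/
theorem Dominant.mul_adj {n i : ℕ} {w : Equiv.Perm ℕ} (h : Dominant n w) (hi : i + 1 < n)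
    (hw : w i < w (i + 1)) (hmin : ∀ a < i, w i < w a) : Dominant n (w * adj i) := by
  intro a b c hab hbc hc h1 h2
  simp only [Equiv.Perm.mul_apply] at h1 h2
  by_cases hs : adj i a < adj i b ∧ adj i b < adj i c
  · refine h _ _ _ hs.1 hs.2 ?_ h1 h2
    rw [adj_apply]
    split_ifs <;> omega
  · simp only [adj_apply] at hs h1 h2
    by_cases e : b = i ∧ c = i + 1
    · obtain ⟨rfl, rfl⟩ := e
      have := hmin a hab
      split_ifs at h1 h2 <;> omega
    · by_cases e' : a = i ∧ b = i + 1
      · obtain ⟨rfl, rfl⟩ := e'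
        split_ifs at h1 h2 <;> omega
      · exfalso
        apply hs
        constructor <;> split_ifs <;> omega

theorem no_ascent_lt {w : Equiv.Perm ℕ} {a b : ℕ} (hab : a < b)
    (h : ∀ i, a ≤ i → i < b → ¬ w i < w (i + 1)) : w b < w a := by
  induction b, hab using Nat.le_induction with
  | base =>
    have h1 := h a le_rfl (Nat.lt_succ_self a)
    have h2 : w (a + 1) ≠ w a := fun e => by have := w.injective e; omega
    show w (a + 1) < w a
    omega
  | succ b hb ih =>
    have h0 := ih fun i hi hi' => h i hi (by omega)
    have h1 := h b (by omega) (by omega)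
    omega

/-- The Schubert polynomial of a dominant permutation is a monomial. -/
theorem Dominant.schubertIn_eq {n : ℕ} {w : Equiv.Perm ℕ} (h : Dominant n w) :
    schubertIn n w = ∏ i ∈ Finset.range n, X i ^ code n w i := by
  induction hN : (nonInversions n w).card using Nat.strong_induction_on generalizing w with
  | _ N ih =>
  subst hN
  by_cases hne : (ascents n w).Nonempty
  · rw [schubertIn_first_ascent hne]
    obtain ⟨hi, hw⟩ := Nat.sInf_mem hne
    -- `w` decreases up to its first ascent.
    have hmin : ∀ a < sInf (ascents n w), w (sInf (ascents n w)) < w a := fun a ha =>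
      no_ascent_lt ha fun k _ hk hk' =>
        Nat.notMem_of_lt_sInf hk ⟨by omega, hk'⟩
    generalize sInf (ascents n w) = i at hi hw hmin
    rw [ih _ (card_nonInversions_lt hi hw) (h.mul_adj hi hw hmin) rfl]
    have split : ∀ c : ℕ → ℕ, (∏ k ∈ Finset.range n, X k ^ c k : MvPolynomial ℕ ℤ) =
        X i ^ c i * X (i + 1) ^ c (i + 1) *
          ∏ k ∈ ((Finset.range n).erase i).erase (i + 1), X k ^ c k := by
      intro c
      rw [mul_assoc, Finset.mul_prod_erase _ (fun k => (X k ^ c k : MvPolynomial ℕ ℤ)),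
        Finset.mul_prod_erase _ (fun k => (X k ^ c k : MvPolynomial ℕ ℤ))]
      · simp; omega
      · simp; omega
    rw [split, split, code_mul_adj_right hw, code_mul_adj_left hi hw, h.code_eq hw]
    have hrest : ∏ k ∈ ((Finset.range n).erase i).erase (i + 1), X k ^ code n (w * adj i) k =
        ∏ k ∈ ((Finset.range n).erase i).erase (i + 1),
          (X k ^ code n w k : MvPolynomial ℕ ℤ) := by
      refine Finset.prod_congr rfl fun k hk => ?_
      simp only [Finset.mem_erase] at hk
      rw [code_mul_adj_of_ne w hi hk.2.1 hk.1]
    rw [hrest]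
    generalize code n w (i + 1) = c
    have hP : act i (∏ k ∈ ((Finset.range n).erase i).erase (i + 1),
          (X k ^ code n w k : MvPolynomial ℕ ℤ)) =
        ∏ k ∈ ((Finset.range n).erase i).erase (i + 1), X k ^ code n w k := by
      rw [map_prod]
      refine Finset.prod_congr rfl fun k hk => ?_
      simp only [Finset.mem_erase] at hk
      rw [map_pow, act_X, adj_apply, if_neg hk.2.1, if_neg hk.1]
    -- The other variables form a factor symmetric under `s_i`, and `∂_i (x_i^(c+1) x_{i+1}^c) =
    -- x_i^c x_{i+1}^c`.
    apply divDiff_eq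
    simp only [map_mul, map_pow, act_X, adj_left, adj_right, hP]
    ring
  · rw [schubertIn_of_no_ascents hne]
    refine Finset.prod_congr rfl fun i hi => ?_
    have hi' := Finset.mem_range.1 hi
    have : (Finset.Ioo i n).filter (fun j => w j < w i) = Finset.Ioo i n := by
      rw [Finset.filter_eq_self]
      intro j hj
      rw [Finset.mem_Ioo] at hj
      exact no_ascent_lt hj.1 fun k _ hk hk' => hne ⟨k, by omega, hk'⟩
    rw [code, this, Nat.card_Ioo]
    congr 1
    omega

theorem Dominant.eval_schubertIn {n : ℕ} {w : Equiv.Perm ℕ} (h : Dominant n w) :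
    eval (fun _ => (1 : ℤ)) (schubertIn n w) = 1 := by
  simp [h.schubertIn_eq, map_prod]

end Dominant

/-! ### Monk's rule for a single variable -/

section Monk

/-- `w * swap a b` covers `w` in the Bruhat order, for positions `a < b`. -/
def IsCover (w : Equiv.Perm ℕ) (a b : ℕ) : Prop :=
  a < b ∧ w a < w b ∧ ∀ c, a < c → c < b → w a < w c → ¬ w c < w b

theorem mul_swap_apply (w : Equiv.Perm ℕ) (a b m : ℕ) :
    (w * Equiv.swap a b) m = if m = a then w b else if m = b then w a else w m := by
  rw [Equiv.Perm.mul_apply, Equiv.swap_apply_def]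
  split_ifs <;> rfl

/-- This matches the terms of Monk's rule for `w * adj i` with those for `w`: the ascent condition
decides which of them survive `∂_i`. -/
theorem isCover_mul_adj {w : Equiv.Perm ℕ} {i a b : ℕ} (hw : w i < w (i + 1))
    (h : ¬ (a = i ∧ b = i + 1)) :
    IsCover w a b ↔ IsCover (w * adj i) (adj i a) (adj i b) ∧
      (w * Equiv.swap a b) i < (w * Equiv.swap a b) (i + 1) := by
  have inj : ∀ x y, w x = w y → x = y := fun x y e => w.injective e
  simp only [IsCover, Equiv.Perm.mul_apply (w : Equiv.Perm ℕ) (adj i), adj_adj]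
  constructor
  · rintro ⟨h1, h2, h3⟩
    refine ⟨⟨?_, h2, ?_⟩, ?_⟩
    · simp only [adj_apply]
      split_ifs <;> omega
    · intro c hc1 hc2 hc3
      by_cases hc : a < adj i c ∧ adj i c < b
      · exact h3 _ hc.1 hc.2 hc3
      · have e1 := h3 i
        have e2 := h3 (i + 1)
        simp only [adj_apply] at hc hc1 hc2 hc3 ⊢
        by_cases ha : a = i
        · subst ha
          split_ifs at hc hc1 hc2 hc3 ⊢ <;> omega
        by_cases hb : b = i + 1
        · subst hb
          split_ifs at hc hc1 hc2 hc3 ⊢ <;> omega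
        by_cases ha' : a = i + 1
        · subst ha'
          split_ifs at hc hc1 hc2 hc3 ⊢ <;> omega
        by_cases hb' : b = i
        · subst hb'
          split_ifs at hc hc1 hc2 hc3 ⊢ <;> omega
        split_ifs at hc hc1 hc2 hc3 ⊢ <;> omega
    · have e1 := h3 i
      have e2 := h3 (i + 1)
      have e3 := inj (i + 1) b
      have e4 := inj i a
      simp only [mul_swap_apply]
      by_cases ha : a = i
      · subst ha
        split_ifs <;> omega
      by_cases hb : b = i + 1
      · subst hb
        split_ifs <;> omega
      by_cases ha' : a = i + 1
      · subst ha'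
        split_ifs <;> omega
      by_cases hb' : b = i
      · subst hb'
        split_ifs <;> omega
      split_ifs <;> omega
  · rintro ⟨⟨h1, h2, h3⟩, h4⟩
    have hab : a < b := by
      by_contra hab
      have : a ≠ b := by rintro rfl; omega
      have : b = i ∧ a = i + 1 := by
        simp only [adj_apply] at h1
        split_ifs at h1 <;> omega
      obtain ⟨rfl, rfl⟩ := this
      omega
    refine ⟨hab, h2, ?_⟩
    intro c hc1 hc2 hc3
    by_cases hc : adj i a < adj i c ∧ adj i c < adj i b
    · have := h3 _ hc.1 hc.2
      rw [adj_adj] at this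
      exact this hc3
    · simp only [mul_swap_apply] at h4
      simp only [adj_apply] at hc
      by_cases ha : a = i
      · subst ha
        by_cases hc' : c = a + 1
        · subst hc'
          split_ifs at h4 <;> omega
        · split_ifs at hc <;> omega
      · by_cases hb : b = i + 1
        · subst hb
          by_cases hc' : c = i
          · subst hc'
            split_ifs at h4 <;> omega
          · split_ifs at hc <;> omega
        · split_ifs at hc <;> omega

open Classical in
/-- The contribution of the position `b` to the expansion of `X r` times a Schubert polynomial. -/
noncomputable def monkTerm (n : ℕ) (w : Equiv.Perm ℕ) (r b : ℕ) : MvPolynomial ℕ ℤ :=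
  if IsCover w r b then schubertIn n (w * Equiv.swap r b)
  else if IsCover w b r then -schubertIn n (w * Equiv.swap r b)
  else 0

theorem IsCover.not_symm {w : Equiv.Perm ℕ} {a b : ℕ} (h : IsCover w a b) : ¬ IsCover w b a :=
  fun h' => absurd h.1 (not_lt.2 h'.1.le)

theorem monkTerm_of_not {n : ℕ} {w : Equiv.Perm ℕ} {r b : ℕ} (h : ¬ IsCover w r b)
    (h' : ¬ IsCover w b r) : monkTerm n w r b = 0 := by
  rw [monkTerm, if_neg h, if_neg h']

theorem mul_adj_mul_swap (w : Equiv.Perm ℕ) (i a b : ℕ) :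
    w * adj i * Equiv.swap (adj i a) (adj i b) * adj i = w * Equiv.swap a b := by
  have h : (adj i)⁻¹ = adj i := inv_eq_of_mul_eq_one_right (adj_mul_self i)
  rw [Equiv.swap_apply_apply, h]
  simp only [mul_assoc, adj_mul_self, mul_one]
  rw [← mul_assoc (adj i), adj_mul_self, one_mul]

open Classical in
theorem divDiff_schubertIn_mul_swap {n i : ℕ} (w : Equiv.Perm ℕ) (hi : i + 1 < n) (a b : ℕ) :
    divDiff i (schubertIn n (w * adj i * Equiv.swap (adj i a) (adj i b))) =
      if (w * Equiv.swap a b) i < (w * Equiv.swap a b) (i + 1) then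
        schubertIn n (w * Equiv.swap a b) else 0 := by
  set u := w * adj i * Equiv.swap (adj i a) (adj i b) with hu
  have hv : w * Equiv.swap a b = u * adj i := (mul_adj_mul_swap w i a b).symm
  have h1 : (u * adj i) i = u (i + 1) := by simp
  have h2 : (u * adj i) (i + 1) = u i := by simp
  rw [hv, h1, h2]
  split_ifs with h
  · exact divDiff_schubertIn_of_descent n u hi h
  · have : u (i + 1) ≠ u i := fun e => by have := u.injective e; omega
    exact divDiff_schubertIn_of_ascent n u hi (by omega)

theorem divDiff_monkTerm {n i : ℕ} {w : Equiv.Perm ℕ} (hi : i + 1 < n) (hw : w i < w (i + 1))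
    {r b : ℕ} (h : ¬ (r = i ∧ b = i + 1)) (h' : ¬ (b = i ∧ r = i + 1)) :
    divDiff i (monkTerm n (w * adj i) (adj i r) (adj i b)) = monkTerm n w r b := by
  have e1 := isCover_mul_adj hw h
  have e2 := isCover_mul_adj hw h'
  rw [Equiv.swap_comm b r] at e2
  have key := divDiff_schubertIn_mul_swap w hi r b
  by_cases c1 : IsCover (w * adj i) (adj i r) (adj i b)
  · rw [monkTerm, if_pos c1, key]
    split_ifs with c2
    · rw [monkTerm, if_pos (e1.2 ⟨c1, c2⟩)]
    · exact (monkTerm_of_not (fun c => c2 (e1.1 c).2) (fun c => c1.not_symm (e2.1 c).1)).symm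
  have n1 : ¬ IsCover w r b := fun c => c1 (e1.1 c).1
  by_cases c2 : IsCover (w * adj i) (adj i b) (adj i r)
  · rw [monkTerm, if_neg c1, if_pos c2, ← divDiffHom_apply, map_neg, divDiffHom_apply, key]
    split_ifs with c3
    · rw [monkTerm, if_neg n1, if_pos (e2.2 ⟨c2, c3⟩)]
    · rw [neg_zero, monkTerm_of_not n1 fun c => c3 (e2.1 c).2]
  · rw [monkTerm_of_not c1 c2, monkTerm_of_not n1 fun c => c2 (e2.1 c).1]
    exact (divDiffHom i).map_zero

theorem monkTerm_adj_left {n i : ℕ} {w : Equiv.Perm ℕ} (hw : w i < w (i + 1)) :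
    monkTerm n w i (i + 1) = schubertIn n (w * adj i) := by
  have : IsCover w i (i + 1) := ⟨by omega, hw, fun c _ _ => by omega⟩
  rw [monkTerm, if_pos this, adj]

theorem monkTerm_adj_right {n i : ℕ} {w : Equiv.Perm ℕ} (hw : w i < w (i + 1)) :
    monkTerm n w (i + 1) i = -schubertIn n (w * adj i) := by
  have : IsCover w i (i + 1) := ⟨by omega, hw, fun c _ _ => by omega⟩
  rw [monkTerm, if_neg this.not_symm, if_pos this, adj, Equiv.swap_comm]

/-- The expansion of `X r` times a Schubert polynomial descends along ascents. -/
theorem monk_of_mul_adj {n i r : ℕ} {w : Equiv.Perm ℕ} (hi : i + 1 < n) (hw : w i < w (i + 1))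
    (ih : X (adj i r) * schubertIn n (w * adj i) =
      ∑ b ∈ Finset.range n, monkTerm n (w * adj i) (adj i r) b) :
    X r * schubertIn n w = ∑ b ∈ Finset.range n, monkTerm n w r b := by
  have reindex : ∑ b ∈ Finset.range n, monkTerm n (w * adj i) (adj i r) b =
      ∑ b ∈ Finset.range n, monkTerm n (w * adj i) (adj i r) (adj i b) := by
    have hr : ∀ b ∈ Finset.range n, adj i b ∈ Finset.range n := by
      intro b hb
      rw [Finset.mem_range] at *
      rw [adj_apply]
      split_ifs <;> omega
    refine Finset.sum_nbij' (adj i) (adj i) hr hr ?_ ?_ ?_ <;> intro b _ <;> simp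
  rw [reindex] at ih
  have h1 := congrArg (divDiffHom i) ih
  rw [map_sum] at h1
  simp only [divDiffHom_apply] at h1
  -- By the Leibniz rule the left side is `X r` times the polynomial of `w`, plus a correction which
  -- vanishes unless `r` is `i` or `i + 1`. In those cases it supplies the term of the pair `(i, i +
  -- 1)`, the one not covered by `divDiff_monkTerm`.
  rw [divDiff_mul, ← schubertIn_ascent n w hi hw, act_X, adj_adj] at h1
  have hdes : (w * adj i) (i + 1) < (w * adj i) i := by simpa using hw
  have c1 : ¬ IsCover (w * adj i) i (i + 1) := fun h => absurd h.2.1 (not_lt.2 hdes.le)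
  have c2 : ¬ IsCover (w * adj i) (i + 1) i := fun h => absurd h.1 (by omega)
  have z : divDiff i 0 = 0 := (divDiffHom i).map_zero
  by_cases hr : r = i
  · subst hr
    rw [adj_left, divDiff_X_right] at h1
    rw [← Finset.add_sum_erase _ _ (Finset.mem_range.2 hi)] at h1 ⊢
    rw [adj_right, monkTerm_of_not c2 c1, z] at h1
    rw [monkTerm_adj_left hw, ← Finset.sum_congr rfl fun b hb => divDiff_monkTerm hi hw
      (r := r) (b := b) (fun e => (Finset.mem_erase.1 hb).1 e.2) (by omega), adj_left]
    linear_combination h1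
  by_cases hr' : r = i + 1
  · subst hr'
    rw [adj_right, divDiff_X_left] at h1
    rw [← Finset.add_sum_erase _ _ (Finset.mem_range.2 (show i < n by omega))] at h1 ⊢
    rw [adj_left, monkTerm_of_not c1 c2, z] at h1
    rw [monkTerm_adj_right hw, ← Finset.sum_congr rfl fun b hb => divDiff_monkTerm hi hw
      (r := i + 1) (b := b) (by omega) (fun e => (Finset.mem_erase.1 hb).1 e.1), adj_right]
    linear_combination h1
  · have e : adj i r = r := by rw [adj_apply, if_neg hr, if_neg hr']
    rw [e, divDiff_X_of_ne hr hr', zero_mul, add_zero] at h1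
    rw [h1]
    refine Finset.sum_congr rfl fun b _ => ?_
    rw [← divDiff_monkTerm hi hw (r := r) (b := b) (by omega) (by omega), e]

/-- The expansion of `X r` times the Schubert polynomial of a permutation with a single
ascent, at `r`, which has at most one larger value after the position `r`. -/
theorem monk_single_ascent {n r : ℕ} {w : Equiv.Perm ℕ} (hr : r + 1 < n) (hw : w r < w (r + 1))
    (hbefore : ∀ a < r, w r < w a) (hafter : ∀ b, r + 1 < b → b < n → w b < w r)
    (hdec : ∀ a b, a < b → b < n → ¬ (a ≤ r ∧ r < b) → w b < w a) :
    X r * schubertIn n w = ∑ b ∈ Finset.range n, monkTerm n w r b := by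
  have hdom : Dominant n w := by
    intro a b c hab hbc hc h1 h2
    have e1 := hdec a c (by omega) hc
    have e2 := hafter c
    have e3 := hdec a b hab (by omega)
    by_cases har : a = r
    · subst har
      omega
    · have e4 := hbefore a
      omega
  have hdom' := hdom.mul_adj hr hw hbefore
  rw [Finset.sum_eq_single_of_mem (r + 1) (Finset.mem_range.2 hr), monkTerm_adj_left hw,
    hdom.schubertIn_eq, hdom'.schubertIn_eq,
    ← Finset.mul_prod_erase _ _ (Finset.mem_range.2 (show r < n by omega)),
    ← Finset.mul_prod_erase _ _ (Finset.mem_range.2 (show r < n by omega)),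
    code_mul_adj_left hr hw, hdom.code_eq hw]
  · rw [pow_succ', mul_assoc]
    congr 2
    refine Finset.prod_congr rfl fun k hk => ?_
    by_cases hk' : k = r + 1
    · rw [hk', code_mul_adj_right hw, hdom.code_eq hw]
    · rw [code_mul_adj_of_ne w hr (Finset.mem_erase.1 hk).1 hk']
  · intro b hb hne
    rw [Finset.mem_range] at hb
    apply monkTerm_of_not
    · rintro ⟨h1, h2, -⟩
      have := hafter b (by omega) hb
      omega
    · rintro ⟨h1, h2, -⟩
      have := hbefore b h1
      omega

/-- Monk's rule for multiplication by a variable `X r`, inside `S_n`. -/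
theorem monk {n r : ℕ} {w : Equiv.Perm ℕ} (h : ∃ b, r < b ∧ b < n ∧ w r < w b) :
    X r * schubertIn n w = ∑ b ∈ Finset.range n, monkTerm n w r b := by
  induction hN : (nonInversions n w).card using Nat.strong_induction_on generalizing w r with
  | _ N ih =>
  subst hN
  have inj : ∀ x y, w x = w y → x = y := fun x y e => w.injective e
  obtain ⟨b, hrb, hb, hwb⟩ := h
  -- The hypothesis, a larger value at a later position below `n`, keeps the expansion inside `S_n`.
  -- An exchange at an ascent other than `r` preserves it.
  by_cases h1 : ∃ i, i ≠ r ∧ i + 1 < n ∧ w i < w (i + 1)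
  · obtain ⟨i, hir, hi, hw⟩ := h1
    refine monk_of_mul_adj hi hw (ih _ (card_nonInversions_lt hi hw) ⟨adj i b, ?_, ?_, ?_⟩ rfl)
    · simp only [adj_apply]
      split_ifs <;> omega
    · rw [adj_apply]
      split_ifs <;> omega
    · simpa using hwb
  · push Not at h1
    have dec : ∀ a c, a < c → c < n → ¬ (a ≤ r ∧ r < c) → w c < w a := by
      intro a c hac hc hr
      refine no_ascent_lt hac fun i hi hi' => not_lt.2 (h1 i ?_ (by omega))
      omega
    have hw : w r < w (r + 1) := by
      by_cases hb' : b = r + 1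
      · rwa [← hb']
      · have := dec (r + 1) b (by omega) hb (by omega)
        omega
    -- With `r` the only ascent, the exchange at `r` moves `w r` to `r + 1`, so a second larger
    -- value, at `r + 2`, is needed. Otherwise both sides are monomials.
    by_cases h2 : r + 2 < n ∧ w r < w (r + 2)
    · refine monk_of_mul_adj (show r + 1 < n by omega) hw
        (ih _ (card_nonInversions_lt (by omega) hw) ⟨r + 2, ?_, h2.1, ?_⟩ rfl)
      · simp
      · simp only [adj_left, mul_adj_apply]
        simpa using h2.2
    · refine monk_single_ascent (by omega) hw (fun a ha => dec a r ha (by omega) (by omega)) ?_ dec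
      intro c hc hcn
      have e := inj r (r + 2)
      by_cases hc' : c = r + 2
      · subst hc'
        omega
      · have := dec (r + 2) c (by omega) hcn (by omega)
        omega

end Monk

/-! ### Patterns lost and gained in a transition -/

section Counting

/-- The occurrences of `132` at positions below `n`. -/
def occ132 (n : ℕ) (w : Equiv.Perm ℕ) : Finset (ℕ × ℕ × ℕ) :=
  (Finset.range n ×ˢ Finset.range n ×ˢ Finset.range n).filter fun p =>
    p.1 < p.2.1 ∧ p.2.1 < p.2.2 ∧ w p.1 < w p.2.2 ∧ w p.2.2 < w p.2.1

/-- The occurrences of `1432` at positions below `n`. -/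
def occ1432 (n : ℕ) (w : Equiv.Perm ℕ) : Finset (ℕ × ℕ × ℕ × ℕ) :=
  (Finset.range n ×ˢ Finset.range n ×ˢ Finset.range n ×ˢ Finset.range n).filter fun p =>
    p.1 < p.2.1 ∧ p.2.1 < p.2.2.1 ∧ p.2.2.1 < p.2.2.2 ∧
      w p.1 < w p.2.2.2 ∧ w p.2.2.2 < w p.2.2.1 ∧ w p.2.2.1 < w p.2.1

theorem mem_occ132 {n : ℕ} {w : Equiv.Perm ℕ} {a b c : ℕ} :
    (a, b, c) ∈ occ132 n w ↔ a < b ∧ b < c ∧ c < n ∧ w a < w c ∧ w c < w b := by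
  simp only [occ132, Finset.mem_filter, Finset.mem_product, Finset.mem_range]
  constructor <;> intro h <;> omega

theorem mem_occ1432 {n : ℕ} {w : Equiv.Perm ℕ} {a b c d : ℕ} :
    (a, b, c, d) ∈ occ1432 n w ↔
      a < b ∧ b < c ∧ c < d ∧ d < n ∧ w a < w d ∧ w d < w c ∧ w c < w b := by
  simp only [occ1432, Finset.mem_filter, Finset.mem_product, Finset.mem_range]
  constructor <;> intro h <;> omega

/-- `r` is the last descent of `w` below `n`, and `s` is the last position below `n` whose value is
smaller than that of `r`. -/
structure IsLastInversion (n : ℕ) (w : Equiv.Perm ℕ) (r s : ℕ) : Prop where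
  lt : r < s
  lt_n : s < n
  inv : w s < w r
  mid : ∀ b, r < b → b < s → w b < w s
  last : ∀ b, s < b → b < n → w r < w b
  mono : ∀ b c, r < b → b < c → c < n → w b < w c

/-- The pairs of positions that measure the loss of patterns when the values at `r` and `s` are
exchanged. -/
def lostPairs (n : ℕ) (w : Equiv.Perm ℕ) (r s : ℕ) : Finset (ℕ × ℕ) :=
  (Finset.range n ×ˢ Finset.range n).filter fun p =>
    p.1 < p.2 ∧ p.2 ≤ r ∧ w p.1 < w s ∧ w r ≤ w p.2

variable {n r s : ℕ} {w : Equiv.Perm ℕ}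

theorem IsLastInversion.mem_lostPairs (h : IsLastInversion n w r s) {a b : ℕ} :
    (a, b) ∈ lostPairs n w r s ↔ a < b ∧ b ≤ r ∧ w a < w s ∧ w r ≤ w b := by
  have h1 := h.lt
  have h2 := h.lt_n
  simp only [lostPairs, Finset.mem_filter, Finset.mem_product, Finset.mem_range]
  constructor <;> intro h <;> omega

theorem IsLastInversion.card_occ132_le (h : IsLastInversion n w r s) :
    (occ132 n w).card ≤ (occ132 n (w * Equiv.swap r s)).card +
      ((lostPairs n w r s).filter fun p => p.2 = r).card := by
  have h1 := h.lt
  have h2 := h.lt_n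
  have h3 := h.inv
  rw [← Finset.card_filter_add_card_filter_not (s := occ132 n w)
    (fun p => p.2.1 = r ∧ p.2.2 = s), add_comm]
  apply add_le_add
  -- If the middle position is before `r`, the last letter follows its value under the exchange.
  -- Otherwise the middle position is `r`, as `w` increases beyond `r`; the last letter is then
  -- before `s` and its value below `w s`, so the occurrence survives in place.
  · apply Finset.card_le_card_of_injOn (fun p : ℕ × ℕ × ℕ => if p.2.1 < r then
      (p.1, p.2.1, if p.2.2 = r then s else if p.2.2 = s then r else p.2.2) else p)
    · rintro ⟨a, b, c⟩ hp
      rw [Finset.mem_coe, Finset.mem_filter, mem_occ132] at hp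
      have e1 := h.mono b c
      have e2 := h.mid c
      have e3 := h.last c
      dsimp only at hp ⊢
      rw [Finset.mem_coe]
      split_ifs <;> rw [mem_occ132] <;> simp only [mul_swap_apply] <;> split_ifs <;>
        first | omega | (subst_vars; omega)
    · rintro ⟨a, b, c⟩ - ⟨a', b', c'⟩ - heq
      dsimp only at heq
      split_ifs at heq <;> simp only [Prod.mk.injEq] at heq ⊢ <;> omega
  · apply Finset.card_le_card_of_injOn (fun p : ℕ × ℕ × ℕ => (p.1, p.2.1))
    · rintro ⟨a, b, c⟩ hp
      rw [Finset.mem_coe, Finset.mem_filter, mem_occ132] at hp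
      dsimp only at hp
      obtain ⟨hp, rfl, rfl⟩ := hp
      rw [Finset.mem_coe, Finset.mem_filter, h.mem_lostPairs]
      dsimp only
      omega
    · rintro ⟨a, b, c⟩ hp ⟨a', b', c'⟩ hp' heq
      rw [Finset.mem_coe, Finset.mem_filter] at hp hp'
      simp only [Prod.mk.injEq] at hp hp' heq ⊢
      omega

theorem IsLastInversion.card_occ1432_le (h : IsLastInversion n w r s) :
    (occ1432 n w).card ≤ (occ1432 n (w * Equiv.swap r s)).card +
      ((lostPairs n w r s).filter fun p => ¬ p.2 = r).card := by
  have h1 := h.lt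
  have h2 := h.lt_n
  have h3 := h.inv
  rw [← Finset.card_filter_add_card_filter_not (s := occ1432 n w)
    (fun p => p.2.2.1 = r ∧ p.2.2.2 = s), add_comm]
  apply add_le_add
  · apply Finset.card_le_card_of_injOn (fun p : ℕ × ℕ × ℕ × ℕ => if p.2.2.1 < r then
      (p.1, p.2.1, p.2.2.1,
        if p.2.2.2 = r then s else if p.2.2.2 = s then r else p.2.2.2) else p)
    · rintro ⟨a, b, c, d⟩ hp
      rw [Finset.mem_coe, Finset.mem_filter, mem_occ1432] at hp
      have e1 := h.mono c d
      have e2 := h.mid d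
      have e3 := h.last d
      dsimp only at hp ⊢
      rw [Finset.mem_coe]
      split_ifs <;> rw [mem_occ1432] <;> simp only [mul_swap_apply] <;> split_ifs <;>
        first | omega | (subst_vars; omega)
    · rintro ⟨a, b, c, d⟩ - ⟨a', b', c', d'⟩ - heq
      dsimp only at heq
      split_ifs at heq <;> simp only [Prod.mk.injEq] at heq ⊢ <;> omega
  · apply Finset.card_le_card_of_injOn (fun p : ℕ × ℕ × ℕ × ℕ => (p.1, p.2.1))
    · rintro ⟨a, b, c, d⟩ hp
      rw [Finset.mem_coe, Finset.mem_filter, mem_occ1432] at hp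
      dsimp only at hp
      obtain ⟨hp, rfl, rfl⟩ := hp
      rw [Finset.mem_coe, Finset.mem_filter, h.mem_lostPairs]
      dsimp only
      omega
    · rintro ⟨a, b, c, d⟩ hp ⟨a', b', c', d'⟩ hp' heq
      rw [Finset.mem_coe, Finset.mem_filter] at hp hp'
      simp only [Prod.mk.injEq] at hp hp' heq ⊢
      omega

/-- The last position `j < r` with `a ≤ j` and `w a ≤ w j < w s` works: a position violating the
cover condition would be a later candidate. -/
theorem IsLastInversion.exists_isCover (h : IsLastInversion n w r s) {a : ℕ} (har : a < r)
    (ha : w a < w s) :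
    ∃ j, a ≤ j ∧ w a ≤ w j ∧ IsCover (w * Equiv.swap r s) j r := by
  have h1 := h.lt
  obtain ⟨j, hj, hmax⟩ := Finset.exists_max_image
    ((Finset.range r).filter fun j => a ≤ j ∧ w a ≤ w j ∧ w j < w s) id ⟨a, by simp [har, ha]⟩
  simp only [Finset.mem_filter, Finset.mem_range, id] at hj hmax
  refine ⟨j, hj.2.1, hj.2.2.1, hj.1, ?_, ?_⟩
  · simp only [mul_swap_apply]
    split_ifs <;> omega
  · intro c hc1 hc2
    have := hmax c
    simp only [mul_swap_apply]
    split_ifs <;> omega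

/-- The lost pairs attached to a position `j` inject into the patterns gained by moving the value
at `s` to `j`. -/
theorem IsLastInversion.card_lostPairs_filter_le (h : IsLastInversion n w r s) {j : ℕ}
    (hj : j < r) (hjs : w j < w s) :
    ((lostPairs n w r s).filter fun p => p.1 ≤ j ∧ w p.1 ≤ w j).card ≤
      1 + (occ132 n (w * Equiv.swap r s * Equiv.swap r j)).card +
        (occ1432 n (w * Equiv.swap r s * Equiv.swap r j)).card := by
  have h1 := h.lt
  have h2 := h.lt_n
  have h3 := h.inv
  have hw : ∀ x, (w * Equiv.swap r s * Equiv.swap r j) x =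
      if x = j then w s else if x = r then w j else if x = s then w r else w x := by
    intro x
    simp only [mul_swap_apply]
    split_ifs <;> first | rfl | omega
  have inj : ∀ x y, w x = w y → x = y := fun x y e => w.injective e
  generalize w * Equiv.swap r s * Equiv.swap r j = u at hw
  generalize hD : (lostPairs n w r s).filter (fun p => p.1 ≤ j ∧ w p.1 ≤ w j) = D
  have hmem : ∀ a b, (a, b) ∈ D → (a < b ∧ b ≤ r ∧ w a < w s ∧ w r ≤ w b) ∧
      a ≤ j ∧ w a ≤ w j := by
    intro a b hab
    rwa [← hD, Finset.mem_filter, h.mem_lostPairs] at hab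
  -- The pair `(j, r)` accounts for the summand `1`.
  rw [← Finset.card_filter_add_card_filter_not (s := D) (fun p => p.1 = j ∧ p.2 = r), add_assoc]
  apply add_le_add
  · rw [Finset.card_le_one]
    rintro ⟨a, b⟩ hp ⟨a', b'⟩ hp'
    simp only [Finset.mem_filter, Prod.mk.injEq] at hp hp' ⊢
    omega
  rw [← Finset.card_filter_add_card_filter_not (s := D.filter _) (fun p => p.2 < j), add_comm]
  apply add_le_add
  -- `u` has the values `w s`, `w j`, `w r` at `j`, `r`, `s`. Here `b > j`, since `w j < w r ≤ w b`;
  -- the images differ in whether they start at `j` or have `j` in the middle.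
  · apply Finset.card_le_card_of_injOn (fun p : ℕ × ℕ =>
      if p.1 = j then (j, p.2, s) else if p.2 = r then (p.1, j, r) else (p.1, p.2, r))
    · rintro ⟨a, b⟩ hp
      simp only [Finset.coe_filter, Set.mem_ofPred_eq, Finset.mem_filter] at hp
      have e := hmem a b hp.1.1
      have e1 := inj a j
      have e2 := inj b r
      have e3 : b ≠ j := by rintro rfl; omega
      dsimp only
      rw [Finset.mem_coe]
      split_ifs <;> rw [mem_occ132] <;> simp only [hw] <;> split_ifs <;>
        omega
    · rintro ⟨a, b⟩ hp ⟨a', b'⟩ hp' heq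
      simp only [Finset.coe_filter, Set.mem_ofPred_eq, Finset.mem_filter] at hp hp'
      have e := hmem a b hp.1.1
      have e' := hmem a' b' hp'.1.1
      have e3 : b ≠ j := by rintro rfl; omega
      have e3' : b' ≠ j := by rintro rfl; omega
      dsimp only at heq
      split_ifs at heq <;> simp only [Prod.mk.injEq] at heq ⊢ <;> omega
  · apply Finset.card_le_card_of_injOn (fun p : ℕ × ℕ => (p.1, p.2, j, r))
    · rintro ⟨a, b⟩ hp
      simp only [Finset.coe_filter, Set.mem_ofPred_eq, Finset.mem_filter] at hp
      have e := hmem a b hp.1.1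
      have e1 := inj a j
      dsimp only
      rw [Finset.mem_coe, mem_occ1432]
      simp only [hw]
      split_ifs <;> omega
    · rintro ⟨a, b⟩ - ⟨a', b'⟩ - heq
      simp only [Prod.mk.injEq] at heq ⊢
      omega

end Counting

section Transition

variable {n r s : ℕ} {w : Equiv.Perm ℕ}

open Classical in
/-- Lascoux's transition formula, under the principal specialization. -/
theorem IsLastInversion.eval_transition (h : IsLastInversion n w r s) :
    eval (fun _ => (1 : ℤ)) (schubertIn n w) =
      eval (fun _ => (1 : ℤ)) (schubertIn n (w * Equiv.swap r s)) +
      ∑ j ∈ (Finset.range n).filter (fun j => IsCover (w * Equiv.swap r s) j r),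
        eval (fun _ => (1 : ℤ)) (schubertIn n (w * Equiv.swap r s * Equiv.swap r j)) := by
  have h1 := h.lt
  have h2 := h.lt_n
  have h3 := h.inv
  set v := w * Equiv.swap r s with hv
  have hvx : ∀ x, v x = if x = r then w s else if x = s then w r else w x :=
    mul_swap_apply w r s
  have hvs : v * Equiv.swap r s = w := by
    rw [hv, mul_assoc, Equiv.swap_mul_self, mul_one]
  have hcov : ∀ b < n, IsCover v r b ↔ b = s := by
    intro b hb
    constructor
    · rintro ⟨c1, c2, c3⟩
      have e1 := h.mid b c1
      have e2 := h.last b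
      have e3 := c3 s h1
      simp only [hvx] at c2 e3
      split_ifs at c2 e3 <;> omega
    · rintro rfl
      refine ⟨h1, ?_, ?_⟩
      · simp only [hvx]
        split_ifs <;> omega
      · intro c hc1 hc2
        have := h.mid c hc1 hc2
        simp only [hvx]
        split_ifs <;> omega
  have hterm : ∀ b ∈ Finset.range n, monkTerm n v r b =
      (if b = s then schubertIn n w else 0) +
        if IsCover v b r then -schubertIn n (v * Equiv.swap r b) else 0 := by
    intro b hb
    have hb' := hcov b (Finset.mem_range.1 hb)
    by_cases c : b = s
    · rw [monkTerm, if_pos (hb'.2 c), if_pos c, if_neg (hb'.2 c).not_symm, c, hvs, add_zero]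
    · rw [monkTerm, if_neg (fun e => c (hb'.1 e)), if_neg c, zero_add]
  have hmonk := monk (n := n) (r := r) (w := v) ⟨s, h1, h2, by
    simp only [hvx]
    split_ifs <;> omega⟩
  rw [Finset.sum_congr rfl hterm, Finset.sum_add_distrib, Finset.sum_ite_eq',
    if_pos (Finset.mem_range.2 h2), ← Finset.sum_filter] at hmonk
  have e := congrArg (eval fun _ => (1 : ℤ)) hmonk
  simp only [map_mul, map_add, map_sum, map_neg, eval_X, one_mul, Finset.sum_neg_distrib] at e
  linarith

theorem no_descent_lt {a b : ℕ} (hab : a < b)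
    (h : ∀ i, a ≤ i → i < b → ¬ w (i + 1) < w i) : w a < w b := by
  induction b, hab using Nat.le_induction with
  | base =>
    have h1 := h a le_rfl (Nat.lt_succ_self a)
    have h2 : w (a + 1) ≠ w a := fun e => by have := w.injective e; omega
    show w a < w (a + 1)
    omega
  | succ b hb ih =>
    have h0 := ih fun i hi hi' => h i hi (by omega)
    have h1 := h b (by omega) (by omega)
    omega

theorem exists_isLastInversion (h : ∃ i, i + 1 < n ∧ w (i + 1) < w i) :
    ∃ r s, IsLastInversion n w r s := by
  obtain ⟨i, hi, hi'⟩ := h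
  obtain ⟨r, hr, hrmax⟩ := Finset.exists_max_image
    ((Finset.range n).filter fun i => i + 1 < n ∧ w (i + 1) < w i) id
    ⟨i, by simp only [Finset.mem_filter, Finset.mem_range]; omega⟩
  simp only [Finset.mem_filter, Finset.mem_range, id] at hr hrmax
  obtain ⟨s, hs, hsmax⟩ := Finset.exists_max_image
    ((Finset.range n).filter fun i => r < i ∧ w i < w r) id
    ⟨r + 1, by simp only [Finset.mem_filter, Finset.mem_range]; omega⟩
  simp only [Finset.mem_filter, Finset.mem_range, id] at hs hsmax
  have mono : ∀ b c, r < b → b < c → c < n → w b < w c := by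
    intro b c hb hbc hc
    refine no_descent_lt hbc fun i hi hi' hd => ?_
    have := hrmax i
    omega
  refine ⟨r, s, hs.2.1, hs.1, hs.2.2, fun b hb hbs => mono b s hb hbs hs.1, ?_, mono⟩
  intro b hb hbn
  have e1 := hsmax b
  have e2 : w b ≠ w r := fun e => by have := w.injective e; omega
  omega

theorem lt_of_fixes (hw : ∀ m, n ≤ m → w m = m) {i : ℕ} (hi : i < n) : w i < n := by
  by_contra hc
  have := w.injective (hw (w i) (by omega))
  omega

/-- The values of `w` at positions below `n`, compared from the last position on. -/
def colexKey (n : ℕ) (w : Equiv.Perm ℕ) : Lex ((Fin n)ᵒᵈ → Fin (n + 1)) :=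
  toLex fun i => ⟨min (w (OrderDual.ofDual i : Fin n)) n, by omega⟩

theorem colexKey_lt {u : Equiv.Perm ℕ} (hs : s < n) (hws : w s < n) (hlt : w s < u s)
    (heq : ∀ x, s < x → w x = u x) : colexKey n w < colexKey n u := by
  refine ⟨OrderDual.toDual ⟨s, hs⟩, ?_, ?_⟩
  · intro i hi
    have : s < (OrderDual.ofDual i : Fin n) := hi
    simp only [colexKey, Pi.toLex_apply, heq _ this]
  · simp only [colexKey, Pi.toLex_apply, OrderDual.ofDual_toDual, Fin.mk_lt_mk]
    omega

/-- The lower bound for the principal specialization, with patterns counted below `n`. -/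
theorem one_add_card_le_eval_schubertIn (hw : ∀ m, n ≤ m → w m = m) :
    (1 + (occ132 n w).card + (occ1432 n w).card : ℤ) ≤
      eval (fun _ => (1 : ℤ)) (schubertIn n w) := by
  classical
  induction hk : colexKey n w using WellFoundedGT.induction generalizing w with
  | ind k ih =>
  subst hk
  by_cases hd : ∃ i, i + 1 < n ∧ w (i + 1) < w i
  · obtain ⟨r, s, h⟩ := exists_isLastInversion hd
    have h1 := h.lt
    have h2 := h.lt_n
    have h3 := h.inv
    have hws := lt_of_fixes hw h2
    rw [h.eval_transition]
    have ihv := ih (colexKey n (w * Equiv.swap r s)) (colexKey_lt h2 hws (by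
      rw [mul_swap_apply]
      split_ifs <;> omega) (fun x hx => by
      rw [mul_swap_apply]
      split_ifs <;> omega)) (w := w * Equiv.swap r s) (fun m hm => by
      rw [mul_swap_apply, if_neg (by omega), if_neg (by omega), hw m hm]) rfl
    have ihu : ∀ j ∈ (Finset.range n).filter (fun j => IsCover (w * Equiv.swap r s) j r),
        (((lostPairs n w r s).filter fun p => p.1 ≤ j ∧ w p.1 ≤ w j).card : ℤ) ≤
          eval (fun _ => (1 : ℤ)) (schubertIn n (w * Equiv.swap r s * Equiv.swap r j)) := by
      intro j hj
      obtain ⟨hjr, hjs, -⟩ := (Finset.mem_filter.1 hj).2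
      have hjs' : w j < w s := by
        simp only [mul_swap_apply] at hjs
        split_ifs at hjs <;> omega
      have e1 := h.card_lostPairs_filter_le hjr hjs'
      have e2 := ih (colexKey n (w * Equiv.swap r s * Equiv.swap r j)) (colexKey_lt h2 hws (by
        simp only [mul_swap_apply]
        split_ifs <;> omega) (fun x hx => by
        simp only [mul_swap_apply]
        split_ifs <;> omega)) (w := w * Equiv.swap r s * Equiv.swap r j) (fun m hm => by
        simp only [mul_swap_apply]
        rw [if_neg (by omega), if_neg (by omega), if_neg (by omega), if_neg (by omega),
          hw m hm]) rfl
      refine le_trans ?_ e2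
      exact_mod_cast e1
    have hsub : lostPairs n w r s ⊆
        ((Finset.range n).filter (fun j => IsCover (w * Equiv.swap r s) j r)).biUnion
          fun j => (lostPairs n w r s).filter fun p => p.1 ≤ j ∧ w p.1 ≤ w j := by
      rintro ⟨a, b⟩ hab
      have hab' := h.mem_lostPairs.1 hab
      obtain ⟨j, hj1, hj2, hj3⟩ := h.exists_isCover (a := a) (by omega) hab'.2.2.1
      have := hj3.1
      exact Finset.mem_biUnion.2 ⟨j, Finset.mem_filter.2 ⟨Finset.mem_range.2 (by omega), hj3⟩,
        Finset.mem_filter.2 ⟨hab, hj1, hj2⟩⟩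
    have hcard := (Finset.card_le_card hsub).trans Finset.card_biUnion_le
    have hsum := Finset.sum_le_sum ihu
    have e1 := h.card_occ132_le
    have e2 := h.card_occ1432_le
    have e3 := Finset.card_filter_add_card_filter_not (s := lostPairs n w r s) (fun p => p.2 = r)
    rw [← Nat.cast_le (α := ℤ), Nat.cast_sum] at hcard
    rw [← Nat.cast_le (α := ℤ), Nat.cast_add] at e1 e2
    rw [← Nat.cast_inj (R := ℤ), Nat.cast_add] at e3
    linarith
  · push Not at hd
    have mono : ∀ a b, a < b → b < n → w a < w b := fun a b hab hb =>
      no_descent_lt hab fun i _ hi' => not_lt.2 (hd i (by omega))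
    have hdom : Dominant n w := by
      intro a b c _ hbc hc _ h
      have := mono b c hbc hc
      omega
    have e1 : occ132 n w = ∅ := by
      rw [Finset.eq_empty_iff_forall_notMem]
      rintro ⟨a, b, c⟩ h
      rw [mem_occ132] at h
      have := mono b c h.2.1 h.2.2.1
      omega
    have e2 : occ1432 n w = ∅ := by
      rw [Finset.eq_empty_iff_forall_notMem]
      rintro ⟨a, b, c, d⟩ h
      rw [mem_occ1432] at h
      have := mono b c h.2.1 (by omega)
      omega
    rw [e1, e2, hdom.eval_schubertIn]
    simp

end Transition

section PatternCount

variable {n : ℕ} {w : Equiv.Perm ℕ}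

theorem lt_of_inversion (hw : ∀ m, n ≤ m → w m = m) {a b : ℕ} (hab : a < b)
    (h : w b < w a) : b < n := by
  by_contra hb
  rw [hw b (by omega)] at h
  have := w.injective (hw (w a) (by omega))
  omega

theorem patternCount_pattern132_le (hw : ∀ m, n ≤ m → w m = m) :
    patternCount pattern132 w ≤ (occ132 n w).card := by
  rw [patternCount, ← Set.ncard_coe_finset]
  apply Set.ncard_le_ncard_of_injOn (fun a => (a 0, a 1, a 2)) _ _ (Finset.finite_toSet _)
  · rintro a ⟨ha, h⟩
    have p01 := ha (show (0 : Fin 3) < 1 by decide)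
    have p12 := ha (show (1 : Fin 3) < 2 by decide)
    have w02 := (h 0 2 (by decide)).2 (by decide)
    have w12 : ¬ w (a 1) < w (a 2) := fun e => absurd ((h 1 2 (by decide)).1 e) (by decide)
    have ne : w (a 1) ≠ w (a 2) := fun e => by have := w.injective e; omega
    have w21 : w (a 2) < w (a 1) := by omega
    rw [Finset.mem_coe, mem_occ132]
    exact ⟨p01, p12, lt_of_inversion hw p12 w21, w02, w21⟩
  · intro a _ b _ h
    simp only [Prod.mk.injEq] at h
    funext i
    fin_cases i
    exacts [h.1, h.2.1, h.2.2]

theorem patternCount_pattern1432_le (hw : ∀ m, n ≤ m → w m = m) :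
    patternCount pattern1432 w ≤ (occ1432 n w).card := by
  rw [patternCount, ← Set.ncard_coe_finset]
  apply Set.ncard_le_ncard_of_injOn (fun a => (a 0, a 1, a 2, a 3)) _ _ (Finset.finite_toSet _)
  · rintro a ⟨ha, h⟩
    have p01 := ha (show (0 : Fin 4) < 1 by decide)
    have p12 := ha (show (1 : Fin 4) < 2 by decide)
    have p23 := ha (show (2 : Fin 4) < 3 by decide)
    have w03 := (h 0 3 (by decide)).2 (by decide)
    have w12 : ¬ w (a 1) < w (a 2) := fun e => absurd ((h 1 2 (by decide)).1 e) (by decide)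
    have w23 : ¬ w (a 2) < w (a 3) := fun e => absurd ((h 2 3 (by decide)).1 e) (by decide)
    have ne : w (a 1) ≠ w (a 2) := fun e => by have := w.injective e; omega
    have ne' : w (a 2) ≠ w (a 3) := fun e => by have := w.injective e; omega
    have w32 : w (a 3) < w (a 2) := by omega
    rw [Finset.mem_coe, mem_occ1432]
    exact ⟨p01, p12, p23, lt_of_inversion hw p23 w32, w03, w32, by omega⟩
  · intro a _ b _ h
    simp only [Prod.mk.injEq] at h
    funext i
    fin_cases i
    exacts [h.1, h.2.1, h.2.2.1, h.2.2.2]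

end PatternCount

end Schubert

theorem mainTheorem1 (w : Equiv.Perm ℕ) (hw : {m | w m ≠ m}.Finite) :
    1 + (Schubert.patternCount Schubert.pattern132 w : ℤ)
        + (Schubert.patternCount Schubert.pattern1432 w : ℤ)
      ≤ MvPolynomial.eval (fun _ => (1 : ℤ)) (Schubert.schubert w) := by
  have hfix := Schubert.fixes_of_sInf_le hw
  refine le_trans ?_ (Schubert.one_add_card_le_eval_schubertIn hfix)
  have h1 := Schubert.patternCount_pattern132_le hfix
  have h2 := Schubert.patternCount_pattern1432_le hfix
  rw [← Nat.cast_le (α := ℤ)] at h1 h2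
  linarith
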